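/- For two rooted trees $T,T'$ and $d\ge 0$, let $W_d(T,T')$ be the largest number of leaves of a rooted tree $t$, all of whose leaves are at depth exactly $d$, such that $t$ embeds injectively both in $T$ and in $T'$, each embedding mapping root to root and the parent of every non-root vertex to the parent of its image ($W_d(T,T')=0$ if there is no such $t$). The matching rate of two random rooted trees $\mathcal T,\mathcal T'$ is $$\gamma(\mathcal T,\mathcal T'):=\inf\Big\{\gamma\in\mathbb R:\ \exists\, m,c,d_0>0,\ \forall x\ge 0,\ \forall d\ge d_0,\ \ \mathbb P\big(W_d(\mathcal T,\mathcal T')\ge m\,x\,\gamma^d\big)\le e^{-(x-c)_+}\Big\},$$ where $d$ ranges over the integers, $a_+=\max(a,0)$ and $\inf\emptyset=+\infty$. **Theorem.** For $\lambda>0$ let $\mathcal T,\mathcal T'$ be two independent Galton–Watson trees with offspring distribution $\mathrm{Poisson}(\lambda)$, and let $\gamma(\lambda):=\gamma(\mathcal T,\mathcal T')$. There exists $\lambda_0>1$ such that, for all $\lambda\in(1,\lambda_0]$, $$\gamma(\lambda)<\lambda .$$ -/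

import Mathlib

open MeasureTheory ProbabilityTheory
open scoped NNReal ENNReal

namespace TreeMatching

/-- The depth of a vertex of a rooted tree: the number of edges between it and the root.
(`Order.pred` is the parent map, and `⊥` is the root, which is its own predecessor.) -/
noncomputable def depth (t : RootedTree.{0}) (v : t) : ℕ :=
  sInf {n : ℕ | Order.pred^[n] v = ⊥}

/-- The set of vertices at depth `d`. -/
def level (t : RootedTree.{0}) (d : ℕ) : Set t := {v | depth t v = d}

/-- A leaf is a vertex without children. -/
def IsLeaf (t : RootedTree.{0}) (v : t) : Prop :=
  ∀ u : t, u ≠ ⊥ → Order.pred u ≠ v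

/-- The tree has depth at most `d` and all its leaves have depth exactly `d`. -/
def LeavesAtDepth (d : ℕ) (t : RootedTree.{0}) : Prop :=
  (∀ v, depth t v ≤ d) ∧ ∀ v, IsLeaf t v → depth t v = d

/-- There is an injective map from the vertices of `t` to those of `T` which sends root to root
and commutes with the parent map at every vertex other than the root. -/
def Embeds (t T : RootedTree.{0}) : Prop :=
  ∃ f : t → T, Function.Injective f ∧ f ⊥ = ⊥ ∧
    ∀ v : t, v ≠ ⊥ → f (Order.pred v) = Order.pred (f v)

/-- The common subtrees of `T` and `T'` whose leaves all have depth `d`. -/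
def commonSubtrees (d : ℕ) (T T' : RootedTree.{0}) : Set RootedTree.{0} :=
  {t | LeavesAtDepth d t ∧ Embeds t T ∧ Embeds t T'}

/-- The matching weight of two rooted trees at depth `d`: the largest number of leaves of a common
subtree whose leaves all have depth `d` (it is `0` if there is no such subtree). -/
noncomputable def matchingWeight (d : ℕ) (T T' : RootedTree.{0}) : ℕ∞ :=
  ⨆ t ∈ commonSubtrees d T T', (level t d).encard

/-- The set of real `g` such that, for some `m, c, d₀ > 0`, the probability that the matching
weight at depth `d` is at least `m x g ^ d` is at most `exp (-(x - c)₊)`,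
for all `x ≥ 0` and `d ≥ d₀`. -/
def controlledRates {Ω : Type*} [MeasurableSpace Ω] (P : Measure Ω) (T T' : Ω → RootedTree.{0}) :
    Set ℝ :=
  {g | ∃ (m c : ℝ) (d₀ : ℕ), 0 < m ∧ 0 < c ∧ 0 < d₀ ∧
    ∀ x : ℝ, 0 ≤ x → ∀ d : ℕ, d₀ ≤ d →
      P {ω | ((m * x * g ^ d : ℝ) : EReal) ≤
          (((matchingWeight d (T ω) (T' ω) : ℕ∞) : ℝ≥0∞) : EReal)} ≤
        ENNReal.ofReal (Real.exp (-(max (x - c) 0)))}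

/-- The matching rate of two random rooted trees.  The infimum is taken in the extended reals, so
that it is `⊤` if no rate is controlled. -/
noncomputable def matchingRate {Ω : Type*} [MeasurableSpace Ω] (P : Measure Ω)
    (T T' : Ω → RootedTree.{0}) : EReal :=
  ⨅ g ∈ controlledRates P T T', (g : EReal)

/-- The words (Ulam-Harris labels) of the tree in which the vertex with label `u` has `N u`
children, labelled `u ++ [i]` for `i < N u`; the root is the empty word. -/
def IsNode (N : List ℕ → ℕ) (v : List ℕ) : Prop :=
  ∀ (u : List ℕ) (i : ℕ), (u ++ [i]) <+: v → i < N u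

theorem isNode_nil (N : List ℕ → ℕ) : IsNode N [] := by
  intro u i h
  simp at h

theorem IsNode.of_prefix {N : List ℕ → ℕ} {v w : List ℕ} (h : IsNode N v) (hw : w <+: v) :
    IsNode N w :=
  fun u i hu => h u i (hu.trans hw)

/-- The longest common prefix of two words. -/
def commonPrefix : List ℕ → List ℕ → List ℕ
  | a :: u, b :: v => if a = b then a :: commonPrefix u v else []
  | _, _ => []

theorem prefix_commonPrefix_iff (w u v : List ℕ) :
    w <+: commonPrefix u v ↔ w <+: u ∧ w <+: v := by
  induction w generalizing u v with
  | nil => simp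
  | cons c w ih =>
    cases u with
    | nil => simp [commonPrefix]
    | cons a u =>
      cases v with
      | nil => simp [commonPrefix]
      | cons b v =>
        by_cases hab : a = b
        · subst hab
          simp only [commonPrefix, if_true, List.cons_prefix_cons, ih]
          tauto
        · simp only [commonPrefix, if_neg hab, List.cons_prefix_cons]
          constructor
          · intro h
            simp at h
          · rintro ⟨⟨rfl, _⟩, rfl, _⟩
            exact absurd rfl hab

/-- The vertices of the tree in which the vertex with label `u` has `N u` children. -/
structure Node (N : List ℕ → ℕ) : Type where
  label : List ℕ
  isNode : IsNode N label

@[ext]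
theorem Node.ext' {N : List ℕ → ℕ} {v w : Node N} (h : v.label = w.label) : v = w := by
  cases v
  cases w
  congr

/-- Vertices are ordered by ancestorship, that is, by the prefix order of their labels. -/
instance (N : List ℕ → ℕ) : SemilatticeInf (Node N) where
  le v w := v.label <+: w.label
  le_refl v := List.prefix_rfl
  le_trans _ _ _ h h' := List.IsPrefix.trans h h'
  le_antisymm _ _ h h' := Node.ext' (h.eq_of_length (le_antisymm h.length_le h'.length_le))
  inf v w := ⟨commonPrefix v.label w.label,
    v.isNode.of_prefix ((prefix_commonPrefix_iff _ _ _).mp List.prefix_rfl).1⟩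
  inf_le_left _ _ := ((prefix_commonPrefix_iff _ _ _).mp List.prefix_rfl).1
  inf_le_right _ _ := ((prefix_commonPrefix_iff _ _ _).mp List.prefix_rfl).2
  le_inf _ _ _ h h' := (prefix_commonPrefix_iff _ _ _).mpr ⟨h, h'⟩

theorem Node.le_iff {N : List ℕ → ℕ} {v w : Node N} : v ≤ w ↔ v.label <+: w.label := Iff.rfl

/-- The root is the vertex labelled by the empty word. -/
instance (N : List ℕ → ℕ) : OrderBot (Node N) where
  bot := ⟨[], isNode_nil N⟩
  bot_le _ := List.nil_prefix

/-- The parent of `u ++ [i]` is `u`. -/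
instance (N : List ℕ → ℕ) : PredOrder (Node N) where
  pred v := ⟨v.label.dropLast, v.isNode.of_prefix (List.dropLast_prefix _)⟩
  pred_le v := List.dropLast_prefix _
  min_of_le_pred := by
    intro v hv w _
    have h := (Node.le_iff.mp hv).length_le
    have h0 : v.label = [] := by
      rw [← List.length_eq_zero_iff]
      simp only [List.length_dropLast] at h
      omega
    rw [Node.le_iff, h0]
    exact List.nil_prefix
  le_pred_of_lt := by
    intro v w hvw
    obtain ⟨h1, h2⟩ := lt_iff_le_not_ge.mp hvw
    rw [Node.le_iff] at h1 h2 ⊢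
    refine List.prefix_of_prefix_length_le h1 (List.dropLast_prefix _) ?_
    have hlen : v.label.length ≠ w.label.length := fun h =>
      h2 (h1.eq_of_length h ▸ List.prefix_rfl)
    have := h1.length_le
    simp only [List.length_dropLast]
    omega

instance (N : List ℕ → ℕ) : IsPredArchimedean (Node N) where
  exists_pred_iterate_of_le := by
    intro v w hvw
    obtain ⟨s, hs⟩ := Node.le_iff.mp hvw
    induction s using List.reverseRecOn generalizing w with
    | nil => exact ⟨0, Node.ext' (by simpa using hs.symm)⟩
    | append_singleton s i ih =>
      have hp : (Order.pred w).label = v.label ++ s := by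
        change w.label.dropLast = _
        rw [← hs, ← List.append_assoc, List.dropLast_concat]
      obtain ⟨n, hn⟩ := ih (w := Order.pred w) (Node.le_iff.mpr ⟨s, hp.symm⟩) hp.symm
      exact ⟨n + 1, hn⟩

/-- The rooted tree in which the vertex with label `u` has `N u` children. -/
abbrev ofOffspring (N : List ℕ → ℕ) : RootedTree.{0} where
  α := Node N

/-- The law of the offspring numbers, indexed by all labels, of a Galton-Watson tree with offspring
distribution Poisson with mean `l`: they are independent with that distribution. -/
noncomputable def offspringLaw (l : ℝ≥0) : Measure (List ℕ → ℕ) :=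
  Measure.infinitePi fun _ => poissonMeasure l

/-- The matching rate of two independent Galton-Watson trees with offspring distribution
Poisson with mean `l`. -/
noncomputable def poissonMatchingRate (l : ℝ≥0) : EReal :=
  matchingRate ((offspringLaw l).prod (offspringLaw l))
    (fun N => ofOffspring N.1) (fun N => ofOffspring N.2)

end TreeMatching

/-!
Write `l = 1 + ε`. The matching weight is controlled by a first moment computation, carried out on
common subtrees that are cut at a well chosen depth.

The mean number of pairs of embeddings of a fixed tree with `e` edges into the two Galton-Watson
trees is `l ^ (2 * e)`, so giving each edge the weight `exp (-3 * ε)` makes the recursion over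
generations subcritical: if the mean weight of a pair of trees is `c`, summing over all partial
matchings of the children (`lintegral_matchSum`) gives `exp (u * c) - 1` with `u ≤ 1 / (1 + ε)`,
and this map preserves `[0, ε]` (`lintegral_commonSubtreeSum_le`). The recursion can start from a
large leaf weight, because a leaf of the cut subtree still has descendants many generations below
in both trees, which are independent events of probability at most `8 * ε` each
(`exists_measure_survives_le`). With a leaf weight of constant order `exp 10` the mean stays of
order `ε ^ 2`, below `ε` for small `ε` (`exists_leafWeight`).

A subtree with `n` leaves and `e` edges is thus unlikely if `10 * n - 3 * ε * e` is large, that is,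
if it is large and has few edges per leaf on the scale `1 / ε`. A common subtree with `y` leaves at
depth `d` has such a cut: at the depth where the number of its vertices divided by
`(1 + ε / 2) ^ s` is maximal, the geometric series bounds the number of edges above by `3 / ε` per
leaf, and the number of leaves is of order at least `y / (1 + ε / 2) ^ d`. As the last few
generations are used for survival, the leaf weight also includes a small exponential weight for the
vertices at the bottom (`exists_cut_depth`). Markov's inequality bounds the probability that the
matching weight exceeds `y` by `(d + 1) * exp (-κ * y / (1 + ε / 2) ^ d)`, so that every rate
larger than `1 + ε / 2`, and in particular `1 + 3 * ε / 4 < l`, is controlled.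
-/

namespace TreeMatching

/-! ### The branching structure of Poisson Galton-Watson trees -/

/-- The offspring numbers of the subtree hanging from the `i`-th child of the root. -/
def child (N : List ℕ → ℕ) (i : ℕ) : List ℕ → ℕ := fun u => N (i :: u)

theorem measurable_child : Measurable child :=
  measurable_pi_lambda _ fun i => measurable_pi_lambda _ fun u => measurable_pi_apply (i :: u)

theorem measurable_child_apply (i : ℕ) : Measurable fun N => child N i :=
  (measurable_pi_apply i).comp measurable_child

instance (l : ℝ≥0) : IsProbabilityMeasure (offspringLaw l) := by
  unfold offspringLaw; infer_instance

theorem map_child_offspringLaw (l : ℝ≥0) :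
    (offspringLaw l).map child = Measure.infinitePi fun _ : ℕ => offspringLaw l := by
  have hinj : Function.Injective fun p : ℕ × List ℕ => p.1 :: p.2 := by
    rintro ⟨i, u⟩ ⟨j, v⟩ h
    simpa using h
  have h1 := Measure.map_infinitePi_infinitePi_of_inj (P := fun _ : List ℕ => poissonMeasure l) hinj
  have h2 := Measure.infinitePi_map_curry (ι := ℕ) (κ := List ℕ)
    (μ := fun _ _ => poissonMeasure l)
  unfold offspringLaw
  rw [← h2, ← h1, Measure.map_map (by fun_prop) (by fun_prop)]
  rfl

theorem indepFun_root_child (l : ℝ≥0) :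
    IndepFun (fun N : List ℕ → ℕ => N []) child (offspringLaw l) := by
  have hind : iIndepFun (fun (u : List ℕ) (N : List ℕ → ℕ) => N u) (offspringLaw l) :=
    iIndepFun_infinitePi (P := fun _ : List ℕ => poissonMeasure l) (X := fun _ x => x)
      fun _ => measurable_id
  have hle : ∀ u : List ℕ, MeasurableSpace.comap (fun N : List ℕ → ℕ => N u) inferInstance ≤
      MeasurableSpace.pi := fun u => (measurable_pi_apply u).comap_le
  have h := indep_iSup_of_disjoint hle hind
    (S := {[]}) (T := {[]}ᶜ) disjoint_compl_right
  rw [IndepFun_iff_Indep]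
  refine indep_of_indep_of_le_left (indep_of_indep_of_le_right h ?_) ?_
  · rw [← measurable_iff_comap_le]
    refine @measurable_pi_lambda _ _ _ (_) _ _ fun i => @measurable_pi_lambda _ _ _ (_) _ _ fun u => ?_
    rw [measurable_iff_comap_le]
    exact le_iSup₂_of_le (i :: u) (by simp) le_rfl
  · exact le_iSup₂_of_le [] rfl le_rfl

/-- The offspring number of the root is Poisson and the subtrees at its potential children are
independent copies of the whole tree, independent of that number. -/
theorem lintegral_offspringLaw (l : ℝ≥0) {F : ℕ × (ℕ → List ℕ → ℕ) → ℝ≥0∞} (hF : Measurable F) :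
    ∫⁻ N, F (N [], child N) ∂offspringLaw l =
      ∫⁻ a, ∫⁻ M, F (a, M) ∂(Measure.infinitePi fun _ : ℕ => offspringLaw l)
        ∂poissonMeasure l := by
  have h := (indepFun_iff_map_prod_eq_prod_map_map (measurable_pi_apply []).aemeasurable
    measurable_child.aemeasurable).1 (indepFun_root_child l)
  have h0 : (offspringLaw l).map (fun N : List ℕ → ℕ => N []) = poissonMeasure l :=
    Measure.infinitePi_map_eval (fun _ : List ℕ => poissonMeasure l) []
  rw [h0, map_child_offspringLaw] at h
  rw [← lintegral_prod _ hF.aemeasurable, ← h,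
    lintegral_map hF ((measurable_pi_apply []).prodMk measurable_child)]

theorem lintegral_prod_infinitePi {Ω ι : Type*} [MeasurableSpace Ω] [Fintype ι] (P : Measure Ω)
    [IsProbabilityMeasure P] {σ : ι → ℕ} (hσ : Function.Injective σ) {H : ι → Ω → ℝ≥0∞}
    (hH : ∀ i, Measurable (H i)) :
    ∫⁻ M, ∏ i, H i (M (σ i)) ∂(Measure.infinitePi fun _ : ℕ => P) = ∏ i, ∫⁻ x, H i x ∂P := by
  have h1 : iIndepFun (fun (k : ℕ) (M : ℕ → Ω) => M k) (Measure.infinitePi fun _ : ℕ => P) :=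
    iIndepFun_infinitePi (P := fun _ : ℕ => P) (X := fun _ x => x) fun _ => measurable_id
  have h2 := (h1.precomp hσ).comp H hH
  have h3 := lintegral_prod_eq_prod_lintegral_of_indepFun Finset.univ _ h2
    fun i => (hH i).comp (measurable_pi_apply _)
  refine h3.trans (Finset.prod_congr rfl fun i _ => ?_)
  conv_rhs => rw [← Measure.infinitePi_map_eval (fun _ : ℕ => P) (σ i)]
  rw [lintegral_map (hH i) (measurable_pi_apply _)]
  rfl

theorem lintegral_poissonMeasure (l : ℝ≥0) (f : ℕ → ℝ≥0∞) :
    ∫⁻ n, f n ∂poissonMeasure l =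
      ∑' n : ℕ, ENNReal.ofReal (Real.exp (-l) * l ^ n / n.factorial) * f n := by
  simp [poissonMeasure, lintegral_sum_measure]

theorem lintegral_pow_poissonMeasure (l s : ℝ≥0) :
    ∫⁻ n, (s : ℝ≥0∞) ^ n ∂poissonMeasure l = ENNReal.ofReal (Real.exp (l * s - l)) := by
  rw [lintegral_poissonMeasure]
  have h : HasSum (fun n : ℕ => Real.exp (-l) * ((l * s : ℝ) ^ n / n.factorial))
      (Real.exp (-l) * Real.exp (l * s)) := by
    rw [Real.exp_eq_exp_ℝ]
    exact (NormedSpace.expSeries_div_hasSum_exp (l * s : ℝ)).mul_left _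
  rw [sub_eq_neg_add, Real.exp_add, ← h.tsum_eq,
    ENNReal.ofReal_tsum_of_nonneg (fun n => by positivity) h.summable]
  refine tsum_congr fun n => ?_
  rw [← ENNReal.ofReal_coe_nnreal, ← ENNReal.ofReal_pow s.coe_nonneg,
    ← ENNReal.ofReal_mul (by positivity)]
  congr 1
  rw [mul_pow]
  ring

theorem lintegral_descFactorial_poissonMeasure (l : ℝ≥0) (k : ℕ) :
    ∫⁻ n, (n.descFactorial k : ℝ≥0∞) ∂poissonMeasure l = (l : ℝ≥0∞) ^ k := by
  rw [lintegral_poissonMeasure, ← (ENNReal.summable.sum_add_tsum_nat_add' (k := k)),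
    Finset.sum_eq_zero, zero_add]
  · have h := hasSum_one_poissonMeasure l
    have h2 : ∑' n : ℕ, ENNReal.ofReal (Real.exp (-l) * l ^ n / n.factorial) = 1 := by
      rw [← ENNReal.ofReal_tsum_of_nonneg (fun n => by positivity) h.summable, h.tsum_eq,
        ENNReal.ofReal_one]
    rw [← mul_one ((l : ℝ≥0∞) ^ k), ← h2, ← ENNReal.tsum_mul_left]
    refine tsum_congr fun n => ?_
    rw [← ENNReal.ofReal_coe_nnreal, ← ENNReal.ofReal_pow l.coe_nonneg, ← ENNReal.ofReal_natCast,
      ← ENNReal.ofReal_mul (by positivity), ← ENNReal.ofReal_mul (by positivity)]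
    congr 1
    have h3 := Nat.factorial_mul_descFactorial (Nat.le_add_left k n)
    rw [Nat.add_sub_cancel] at h3
    have h4 : (n.factorial : ℝ) * (n + k).descFactorial k = (n + k).factorial := by
      exact_mod_cast h3
    rw [← h4, pow_add]
    have : (n.factorial : ℝ) ≠ 0 := by positivity
    have : ((n + k).descFactorial k : ℝ) ≠ 0 := by
      have := (Nat.descFactorial_pos (n := n + k) (k := k)).2 (by omega)
      positivity
    change _ = (l : ℝ) ^ k * _
    field_simp
  · intro n hn
    rw [Nat.descFactorial_eq_zero_iff_lt.2 (Finset.mem_range.1 hn)]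
    simp

/-- The sum, over all nonempty partial matchings between the `a` first entries of `M` and the `b`
first entries of `M'`, of the product of the weights of the matched pairs. A partial matching is
its domain `S` together with an injection of `S`. -/
noncomputable def matchSumAux (G : (List ℕ → ℕ) × (List ℕ → ℕ) → ℝ≥0∞) (a b : ℕ)
    (M M' : ℕ → List ℕ → ℕ) : ℝ≥0∞ :=
  ∑ S ∈ (Finset.range a).powerset.erase ∅, ∑ σ : S ↪ Fin b, ∏ i : S, G (M i, M' (σ i))

/-- The sum, over all nonempty partial matchings between the children of the two roots, of the
product of the weights of the matched pairs of subtrees. -/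
noncomputable def matchSum (G : (List ℕ → ℕ) × (List ℕ → ℕ) → ℝ≥0∞)
    (p : (List ℕ → ℕ) × (List ℕ → ℕ)) : ℝ≥0∞ :=
  matchSumAux G (p.1 []) (p.2 []) (child p.1) (child p.2)

theorem measurable_matchSumAux {G : (List ℕ → ℕ) × (List ℕ → ℕ) → ℝ≥0∞} (hG : Measurable G) :
    Measurable fun q : (ℕ × (ℕ → List ℕ → ℕ)) × (ℕ × (ℕ → List ℕ → ℕ)) =>
      matchSumAux G q.1.1 q.2.1 q.1.2 q.2.2 := by
  have h1 : ∀ y : ℕ × ℕ, Measurable fun m : (ℕ → List ℕ → ℕ) × (ℕ → List ℕ → ℕ) =>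
      matchSumAux G y.1 y.2 m.1 m.2 := by
    intro y
    have h2 : ∀ i j : ℕ, Measurable fun m : (ℕ → List ℕ → ℕ) × (ℕ → List ℕ → ℕ) =>
        G (m.1 i, m.2 j) := fun i j => hG.comp (by fun_prop)
    unfold matchSumAux
    exact Finset.measurable_sum _ fun S _ => Finset.measurable_sum _ fun σ _ =>
      Finset.measurable_prod _ fun i _ => h2 i (σ i)
  have h : Measurable fun r : ((ℕ → List ℕ → ℕ) × (ℕ → List ℕ → ℕ)) × (ℕ × ℕ) =>
      matchSumAux G r.2.1 r.2.2 r.1.1 r.1.2 := by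
    apply measurable_from_prod_countable_left
    intro y
    dsimp only
    exact h1 y
  have h3 : Measurable fun q : (ℕ × (ℕ → List ℕ → ℕ)) × (ℕ × (ℕ → List ℕ → ℕ)) =>
      ((q.1.2, q.2.2), (q.1.1, q.2.1)) := by fun_prop
  exact Measurable.comp (f := fun q : (ℕ × (ℕ → List ℕ → ℕ)) × (ℕ × (ℕ → List ℕ → ℕ)) =>
      ((q.1.2, q.2.2), (q.1.1, q.2.1))) h h3

theorem measurable_matchSum {G : (List ℕ → ℕ) × (List ℕ → ℕ) → ℝ≥0∞} (hG : Measurable G) :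
    Measurable (matchSum G) := by
  have h := measurable_child
  exact (measurable_matchSumAux hG).comp
    (f := fun p : (List ℕ → ℕ) × (List ℕ → ℕ) => ((p.1 [], child p.1), (p.2 [], child p.2)))
    (by fun_prop)

/-- The second tree is integrated first: as `E[b (b - 1) ⋯ (b - k + 1)] = l ^ k` for a Poisson
variable `b`, each matching with domain `S` contributes `l ^ |S|` times a product over `S`. -/
theorem lintegral_matchSum_right (l : ℝ≥0) {G : (List ℕ → ℕ) × (List ℕ → ℕ) → ℝ≥0∞}
    (hG : Measurable G) (a : ℕ) (M : ℕ → List ℕ → ℕ) :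
    ∫⁻ N', matchSumAux G a (N' []) M (child N') ∂offspringLaw l =
      ∑ S ∈ (Finset.range a).powerset.erase ∅,
        ∏ i ∈ S, (l : ℝ≥0∞) * ∫⁻ N', G (M i, N') ∂offspringLaw l := by
  have hF : Measurable fun r : ℕ × (ℕ → List ℕ → ℕ) => matchSumAux G a r.1 M r.2 :=
    (measurable_matchSumAux hG).comp
      (f := fun r : ℕ × (ℕ → List ℕ → ℕ) => ((a, M), r)) (by fun_prop)
  rw [lintegral_offspringLaw l hF]
  have h1 : ∀ b : ℕ, ∫⁻ M', matchSumAux G a b M M'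
      ∂(Measure.infinitePi fun _ : ℕ => offspringLaw l) =
      ∑ S ∈ (Finset.range a).powerset.erase ∅, (b.descFactorial S.card : ℝ≥0∞) *
        ∏ i ∈ S, ∫⁻ N', G (M i, N') ∂offspringLaw l := by
    intro b
    have hm : ∀ (S : Finset ℕ) (σ : S ↪ Fin b), Measurable fun M' : ℕ → List ℕ → ℕ =>
        ∏ i : S, G (M i, M' (σ i)) := fun S σ =>
      Finset.measurable_prod _ fun i _ => hG.comp (by fun_prop)
    unfold matchSumAux
    rw [lintegral_finsetSum _ fun S _ => Finset.measurable_sum _ fun σ _ => hm S σ]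
    refine Finset.sum_congr rfl fun S _ => ?_
    rw [lintegral_finsetSum _ fun σ _ => hm S σ]
    have h2 : ∀ σ : S ↪ Fin b, ∫⁻ M', ∏ i : S, G (M i, M' (σ i))
        ∂(Measure.infinitePi fun _ : ℕ => offspringLaw l) =
        ∏ i ∈ S, ∫⁻ N', G (M i, N') ∂offspringLaw l := by
      intro σ
      rw [lintegral_prod_infinitePi (offspringLaw l) (σ := fun i : S => (σ i : ℕ))
        (H := fun (i : S) N' => G (M i, N'))
        (fun i j hij => σ.injective (Fin.ext hij)) (fun i => hG.comp (by fun_prop))]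
      exact Finset.prod_coe_sort S fun i => ∫⁻ N', G (M i, N') ∂offspringLaw l
    simp only [h2, Finset.sum_const, Finset.card_univ, Fintype.card_embedding_eq, Fintype.card_fin,
      Fintype.card_coe, nsmul_eq_mul]
  simp only [h1]
  rw [lintegral_finsetSum _ fun S _ => .of_discrete]
  refine Finset.sum_congr rfl fun S _ => ?_
  rw [lintegral_mul_const _ .of_discrete, lintegral_descFactorial_poissonMeasure,
    Finset.prod_mul_distrib, Finset.prod_const]

/-- The branching recursion: if the weight of a pair of independent trees has mean `c`, then the
sum over nonempty partial matchings has mean `exp (l ^ 2 * c) - 1`. -/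
theorem lintegral_matchSum (l : ℝ≥0) {G : (List ℕ → ℕ) × (List ℕ → ℕ) → ℝ≥0∞}
    (hG : Measurable G) {c : ℝ≥0}
    (hc : ∫⁻ p, G p ∂(offspringLaw l).prod (offspringLaw l) = c) :
    ∫⁻ p, matchSum G p ∂(offspringLaw l).prod (offspringLaw l) + 1 =
      ENNReal.ofReal (Real.exp (l ^ 2 * c)) := by
  rw [lintegral_prod _ (measurable_matchSum hG).aemeasurable]
  unfold matchSum
  simp only [lintegral_matchSum_right l hG]
  have hK : Measurable fun N => ∫⁻ N', G (N, N') ∂offspringLaw l := hG.lintegral_prod_right'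
  have hKc : ∫⁻ N, (l : ℝ≥0∞) * ∫⁻ N', G (N, N') ∂offspringLaw l ∂offspringLaw l =
      (l * c : ℝ≥0) := by
    rw [lintegral_const_mul _ hK, ← lintegral_prod _ hG.aemeasurable, hc, ENNReal.coe_mul]
  have hKi : ∀ i : ℕ, Measurable fun M : ℕ → List ℕ → ℕ =>
      (l : ℝ≥0∞) * ∫⁻ N', G (M i, N') ∂offspringLaw l := fun i =>
    (hK.comp (measurable_pi_apply i)).const_mul _
  have hF : Measurable fun r : ℕ × (ℕ → List ℕ → ℕ) =>
      ∑ S ∈ (Finset.range r.1).powerset.erase ∅,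
        ∏ i ∈ S, (l : ℝ≥0∞) * ∫⁻ N', G (r.2 i, N') ∂offspringLaw l := by
    have h : Measurable fun r : (ℕ → List ℕ → ℕ) × ℕ =>
        ∑ S ∈ (Finset.range r.2).powerset.erase ∅,
          ∏ i ∈ S, (l : ℝ≥0∞) * ∫⁻ N', G (r.1 i, N') ∂offspringLaw l := by
      apply measurable_from_prod_countable_left
      intro a
      dsimp only
      exact Finset.measurable_sum _ fun S _ => Finset.measurable_prod _ fun i _ => hKi i
    exact h.comp measurable_swap
  rw [lintegral_offspringLaw l hF]
  have h1 : ∀ a : ℕ, ∫⁻ M : ℕ → List ℕ → ℕ, ∑ S ∈ (Finset.range a).powerset.erase ∅,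
        ∏ i ∈ S, (l : ℝ≥0∞) * ∫⁻ N', G (M i, N') ∂offspringLaw l
        ∂(Measure.infinitePi fun _ : ℕ => offspringLaw l) =
      ∑ S ∈ (Finset.range a).powerset.erase ∅, ∏ _i ∈ S, ((l * c : ℝ≥0) : ℝ≥0∞) := by
    intro a
    rw [lintegral_finsetSum _ fun S _ =>
        Finset.measurable_prod _ fun i _ => hKi i]
    refine Finset.sum_congr rfl fun S _ => ?_
    rw [← Finset.prod_coe_sort S, ← hKc]
    rw [← lintegral_prod_infinitePi (offspringLaw l) (σ := fun i : S => (i : ℕ))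
        (H := fun (i : S) N => (l : ℝ≥0∞) * ∫⁻ N', G (N, N') ∂offspringLaw l)
        Subtype.val_injective (fun i => hK.const_mul _)]
    refine lintegral_congr fun M => ?_
    exact (Finset.prod_coe_sort S fun i =>
      (l : ℝ≥0∞) * ∫⁻ N', G (M i, N') ∂offspringLaw l).symm
  simp only [h1]
  rw [show (1 : ℝ≥0∞) = ∫⁻ _, 1 ∂poissonMeasure l by simp, ← lintegral_add_right _ .of_discrete]
  have h2 : ∀ a : ℕ, (∑ S ∈ (Finset.range a).powerset.erase ∅,
      ∏ _i ∈ S, ((l * c : ℝ≥0) : ℝ≥0∞)) + 1 = ((1 + l * c : ℝ≥0) : ℝ≥0∞) ^ a := by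
    intro a
    have h3 := Finset.prod_one_add (f := fun _ : ℕ => ((l * c : ℝ≥0) : ℝ≥0∞)) (Finset.range a)
    rw [Finset.prod_const, Finset.card_range] at h3
    rw [ENNReal.coe_add, ENNReal.coe_one, h3,
      ← Finset.sum_erase_add _ _ (Finset.empty_mem_powerset _), Finset.prod_empty]
  simp only [h2]
  rw [lintegral_pow_poissonMeasure]
  congr 2
  push_cast
  ring

/-! ### Common subtrees and their numbers of vertices per generation -/

section Depth

variable {t : RootedTree.{0}}

theorem iterate_pred_depth (v : t) : Order.pred^[depth t v] v = ⊥ :=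
  Nat.sInf_mem (s := {n : ℕ | Order.pred^[n] v = ⊥})
    (IsPredArchimedean.exists_pred_iterate_of_le (bot_le : ⊥ ≤ v))

theorem depth_le_of_iterate {v : t} {n : ℕ} (h : Order.pred^[n] v = ⊥) : depth t v ≤ n :=
  Nat.sInf_le h

theorem depth_bot : depth t ⊥ = 0 := Nat.le_zero.1 (depth_le_of_iterate rfl)

theorem eq_bot_of_depth_eq_zero {v : t} (h : depth t v = 0) : v = ⊥ := by
  have := iterate_pred_depth v
  rwa [h] at this

theorem depth_pred (v : t) : depth t (Order.pred v) = depth t v - 1 := by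
  rcases Nat.eq_zero_or_pos (depth t v) with h | h
  · rw [eq_bot_of_depth_eq_zero h, Order.pred_bot, depth_bot]
  · obtain ⟨k, hk⟩ := Nat.exists_eq_succ_of_ne_zero h.ne'
    have h1 : depth t (Order.pred v) ≤ k := by
      refine depth_le_of_iterate ?_
      rw [← Function.iterate_succ_apply, ← hk, iterate_pred_depth]
    have h2 : depth t v ≤ depth t (Order.pred v) + 1 := by
      refine depth_le_of_iterate ?_
      rw [Function.iterate_succ_apply, iterate_pred_depth]
    omega

theorem depth_iterate_pred (s : ℕ) (v : t) : depth t (Order.pred^[s] v) = depth t v - s := by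
  induction s with
  | zero => rfl
  | succ s ih => rw [Function.iterate_succ_apply', depth_pred, ih]; omega

/-- The vertices that are `s` generations below `v`. The condition on the depth excludes the
spurious solutions of `Order.pred^[s] w = v` that arise because the root is its own parent. -/
def descendants (v : t) (s : ℕ) : Set t :=
  {w | Order.pred^[s] w = v ∧ depth t w = depth t v + s}

theorem descendants_zero (v : t) : descendants v 0 = {v} := by
  ext w
  simp only [descendants, Function.iterate_zero, id_eq, add_zero, Set.mem_ofPred_eq,
    Set.mem_singleton_iff]
  exact ⟨fun h => h.1, fun h => ⟨h, by rw [h]⟩⟩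

theorem mem_descendants_one {v c : t} :
    c ∈ descendants v 1 ↔ c ≠ ⊥ ∧ Order.pred c = v := by
  simp only [descendants, Function.iterate_one, Set.mem_ofPred_eq]
  constructor
  · rintro ⟨h1, h2⟩
    refine ⟨?_, h1⟩
    rintro rfl
    rw [depth_bot] at h2
    omega
  · rintro ⟨h1, rfl⟩
    refine ⟨rfl, ?_⟩
    rw [depth_pred]
    have : depth t c ≠ 0 := fun h => h1 (eq_bot_of_depth_eq_zero h)
    omega

theorem descendants_succ (v : t) (s : ℕ) :
    descendants v (s + 1) = ⋃ c ∈ descendants v 1, descendants c s := by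
  ext w
  simp only [Set.mem_iUnion]
  constructor
  · rintro ⟨h1, h2⟩
    have h3 := depth_iterate_pred s w
    rw [Function.iterate_succ_apply'] at h1
    exact ⟨Order.pred^[s] w, ⟨h1, by omega⟩, rfl, by omega⟩
  · rintro ⟨c, ⟨h1, h2⟩, h3, h4⟩
    refine ⟨?_, by omega⟩
    rw [Function.iterate_succ_apply', h3]
    exact h1

theorem descendants_root (d : ℕ) : descendants (⊥ : t) d = level t d := by
  ext w
  simp only [descendants, level, depth_bot, zero_add, Set.mem_ofPred_eq]
  refine ⟨fun h => h.2, fun h => ⟨?_, h⟩⟩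
  rw [← h, iterate_pred_depth]

end Depth

section Embedding

variable {t : RootedTree.{0}} {N : List ℕ → ℕ} {f : t → Node N}

/-- The last letter of the label of the image of `c`, which is the rank of that image among its
siblings. -/
def childIndex (f : t → Node N) (c : t) : ℕ := (f c).label.getLastD 0

theorem label_eq_append (hf : Function.Injective f) (h0 : f ⊥ = ⊥)
    (hp : ∀ v : t, v ≠ ⊥ → f (Order.pred v) = Order.pred (f v)) {v c : t}
    (hc : c ∈ descendants v 1) : (f c).label = (f v).label ++ [childIndex f c] := by
  obtain ⟨hc0, rfl⟩ := mem_descendants_one.1 hc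
  have hne : (f c).label ≠ [] := fun h => hc0 (hf ((Node.ext' h : f c = ⊥).trans h0.symm))
  rw [hp c hc0]
  change _ = (f c).label.dropLast ++ _
  unfold childIndex
  rw [List.getLastD_eq_getLast?, List.getLast?_eq_getLast_of_ne_nil hne]
  simp [List.dropLast_append_getLast]

theorem childIndex_injOn (hf : Function.Injective f) (h0 : f ⊥ = ⊥)
    (hp : ∀ v : t, v ≠ ⊥ → f (Order.pred v) = Order.pred (f v)) (v : t) :
    Set.InjOn (childIndex f) (descendants v 1) := by
  intro b hb c hc h
  refine hf (Node.ext' ?_)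
  rw [label_eq_append hf h0 hp hb, label_eq_append hf h0 hp hc, h]

theorem childIndex_lt (hf : Function.Injective f) (h0 : f ⊥ = ⊥)
    (hp : ∀ v : t, v ≠ ⊥ → f (Order.pred v) = Order.pred (f v)) {v c : t}
    (hc : c ∈ descendants v 1) : childIndex f c < N (f v).label :=
  (f c).isNode _ _ (by rw [← label_eq_append hf h0 hp hc])

theorem finite_descendants (hf : Function.Injective f) (h0 : f ⊥ = ⊥)
    (hp : ∀ v : t, v ≠ ⊥ → f (Order.pred v) = Order.pred (f v)) (v : t) (s : ℕ) :
    (descendants v s).Finite := by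
  induction s generalizing v with
  | zero => rw [descendants_zero]; exact Set.finite_singleton v
  | succ s ih =>
    rw [descendants_succ]
    refine Set.Finite.biUnion ?_ fun c _ => ih c
    refine Set.Finite.of_finite_image ?_ (childIndex_injOn hf h0 hp v)
    refine (Set.finite_lt_nat (N (f v).label)).subset ?_
    rintro _ ⟨c, hc, rfl⟩
    exact childIndex_lt hf h0 hp hc

end Embedding

/-- `IsProfile d N N' L` says that the trees with offspring numbers `N` and `N'` have a common
subtree, all of whose vertices have descendants at depth `d`, with `L s` vertices at depth `s` for
all `s ≤ d`. The values of `L` at larger arguments carry no information. The common subtree is given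
recursively: by a nonempty partial matching `σ`, with domain `S`, between the children of the two
roots, and a common subtree with profile `K i` for each matched pair of children. -/
def IsProfile : ℕ → (List ℕ → ℕ) → (List ℕ → ℕ) → (ℕ → ℕ) → Prop
  | 0, _, _, L => L 0 = 1
  | d + 1, N, N', L => ∃ S ∈ (Finset.range (N [])).powerset.erase ∅,
      ∃ (σ : S ↪ Fin (N' [])) (K : S → ℕ → ℕ),
        (∀ i : S, IsProfile d (child N i) (child N' (σ i)) (K i)) ∧
          L 0 = 1 ∧ ∀ s, L (s + 1) = ∑ i, K i s

theorem IsProfile.apply_zero {d : ℕ} {N N' : List ℕ → ℕ} {L : ℕ → ℕ} (h : IsProfile d N N' L) :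
    L 0 = 1 := by
  cases d with
  | zero => exact h
  | succ d => obtain ⟨_, _, _, _, _, h, _⟩ := h; exact h

theorem IsProfile.of_add {d k : ℕ} {N N' : List ℕ → ℕ} {L : ℕ → ℕ}
    (h : IsProfile (d + k) N N' L) : IsProfile d N N' L := by
  induction d generalizing N N' L with
  | zero => exact h.apply_zero
  | succ d ih =>
    rw [Nat.add_right_comm] at h
    obtain ⟨S, hS, σ, K, hK, h0, hL⟩ := h
    exact ⟨S, hS, σ, K, fun i => ih (hK i), h0, hL⟩

/-- The vertices below a vertex `v` of a common subtree form a common subtree of the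
trees hanging from the two images of `v`, where these are relabelled by removing the label of the
image. -/
theorem isProfile_descendants {t : RootedTree.{0}} {d : ℕ} (ht : LeavesAtDepth d t)
    {N N' : List ℕ → ℕ} {f : t → Node N} {f' : t → Node N'}
    (hf : Function.Injective f) (h0 : f ⊥ = ⊥)
    (hp : ∀ v : t, v ≠ ⊥ → f (Order.pred v) = Order.pred (f v))
    (hf' : Function.Injective f') (h0' : f' ⊥ = ⊥)
    (hp' : ∀ v : t, v ≠ ⊥ → f' (Order.pred v) = Order.pred (f' v))
    (k : ℕ) (v : t) (hv : depth t v + k = d) :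
    IsProfile k (fun u => N ((f v).label ++ u)) (fun u => N' ((f' v).label ++ u))
      fun s => (descendants v s).ncard := by
  classical
  have hz : ∀ w : t, (descendants w 0).ncard = 1 := fun w => by
    rw [descendants_zero, Set.ncard_singleton]
  induction k generalizing v with
  | zero => exact hz v
  | succ k ih =>
    have hfin := finite_descendants hf h0 hp
    set C : Finset t := (hfin v 1).toFinset with hC
    have memC : ∀ {c : t}, c ∈ C ↔ c ∈ descendants v 1 := Set.Finite.mem_toFinset _
    have hex : ∀ i : C.image (childIndex f), ∃ c, c ∈ C ∧ childIndex f c = i := fun i =>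
      Finset.mem_image.1 i.2
    choose c hcC hci using hex
    have hc : ∀ i, c i ∈ descendants v 1 := fun i => memC.1 (hcC i)
    refine ⟨C.image (childIndex f), ?_,
      ⟨fun i => ⟨childIndex f' (c i), ?_⟩, ?_⟩, fun i s => (descendants (c i) s).ncard,
      ?_, hz v, ?_⟩
    · rw [Finset.mem_erase, Finset.mem_powerset]
      constructor
      · -- A vertex of depth less than `d` is not a leaf.
        have hnl : ¬ IsLeaf t v := fun h => by have := ht.2 v h; omega
        simp only [IsLeaf, not_forall, not_not] at hnl
        obtain ⟨u, hu, huv⟩ := hnl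
        exact Finset.ne_empty_of_mem
          (Finset.mem_image_of_mem _ (memC.2 (mem_descendants_one.2 ⟨hu, huv⟩)))
      · intro i hi
        obtain ⟨b, hb, rfl⟩ := Finset.mem_image.1 hi
        simpa using childIndex_lt hf h0 hp (memC.1 hb)
    · simpa using childIndex_lt hf' h0' hp' (hc i)
    · intro i j hij
      have h1 : childIndex f' (c i) = childIndex f' (c j) := congrArg Fin.val hij
      have h2 := childIndex_injOn hf' h0' hp' v (hc i) (hc j) h1
      exact Subtype.ext (by rw [← hci i, ← hci j, h2])
    · intro i
      have h1 := ih (c i) (by have := (hc i).2; omega)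
      rw [label_eq_append hf h0 hp (hc i), label_eq_append hf' h0' hp' (hc i), hci i] at h1
      simp only [List.append_assoc, List.singleton_append] at h1
      exact h1
    · intro s
      have h1 : ∑ i, (descendants (c i) s).ncard = ∑ b ∈ C, (descendants b s).ncard := by
        refine Finset.sum_bij (fun i _ => c i) (fun i _ => hcC i) ?_ ?_ fun i _ => rfl
        · intro i _ j _ hij
          exact Subtype.ext (by rw [← hci i, ← hci j, hij])
        · intro b hb
          refine ⟨⟨childIndex f b, Finset.mem_image_of_mem _ hb⟩, Finset.mem_univ _, ?_⟩
          exact childIndex_injOn hf h0 hp v (hc _) (memC.1 hb) (hci _)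
      have h2 : (hfin v (s + 1)).toFinset = C.biUnion fun b => (hfin b s).toFinset := by
        ext w
        simp [descendants_succ v s, hC]
      beta_reduce
      rw [h1, Set.ncard_eq_toFinset_card _ (hfin v (s + 1)), h2, Finset.card_biUnion]
      · exact Finset.sum_congr rfl fun b _ => (Set.ncard_eq_toFinset_card _ _).symm
      · intro b _ b' _ hbb'
        rw [Function.onFun, Finset.disjoint_left]
        intro w hw hw'
        rw [Set.Finite.mem_toFinset] at hw hw'
        exact hbb' (hw.1.symm.trans hw'.1)

theorem exists_isProfile_of_mem_commonSubtrees {t : RootedTree.{0}} {d : ℕ} {N N' : List ℕ → ℕ}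
    (ht : t ∈ commonSubtrees d (ofOffspring N) (ofOffspring N')) :
    ∃ L, IsProfile d N N' L ∧ (level t d).encard = L d := by
  obtain ⟨hl, ⟨f, hf, h0, hp⟩, f', hf', h0', hp'⟩ := ht
  have h := isProfile_descendants hl hf h0 hp hf' h0' hp' d ⊥ (by rw [depth_bot, zero_add])
  rw [h0, h0'] at h
  refine ⟨_, h, ?_⟩
  rw [← descendants_root, Set.Finite.cast_ncard_eq (finite_descendants hf h0 hp ⊥ d)]

theorem prod_le_matchSum (G : (List ℕ → ℕ) × (List ℕ → ℕ) → ℝ≥0∞) {N N' : List ℕ → ℕ}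
    {S : Finset ℕ} (hS : S ∈ (Finset.range (N [])).powerset.erase ∅) (σ : S ↪ Fin (N' [])) :
    ∏ i : S, G (child N i, child N' (σ i)) ≤ matchSum G (N, N') := by
  unfold matchSum matchSumAux
  refine le_trans ?_ (Finset.single_le_sum (fun _ _ => zero_le) hS)
  exact Finset.single_le_sum (f := fun σ : S ↪ Fin (N' []) =>
    ∏ i : S, G (child N i, child N' (σ i))) (fun _ _ => zero_le) (Finset.mem_univ σ)

/-- The total weight of the common subtrees of depth `j`, where each edge has weight `x` and a leaf
has the weight that `G` gives to the pair of subtrees hanging from its two images. All leaves have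
depth `j`, and common subtrees are identified if their vertices have the same pairs of images. -/
noncomputable def commonSubtreeSum (x : ℝ≥0∞) (G : (List ℕ → ℕ) × (List ℕ → ℕ) → ℝ≥0∞) :
    ℕ → (List ℕ → ℕ) × (List ℕ → ℕ) → ℝ≥0∞
  | 0 => G
  | j + 1 => matchSum fun p => x * commonSubtreeSum x G j p

theorem measurable_commonSubtreeSum {x : ℝ≥0∞} {G : (List ℕ → ℕ) × (List ℕ → ℕ) → ℝ≥0∞}
    (hG : Measurable G) (j : ℕ) : Measurable (commonSubtreeSum x G j) := by
  induction j with
  | zero => exact hG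
  | succ j ih => exact measurable_matchSum (ih.const_mul x)

/-- A single common subtree, cut at depth `j`, bounds the sum over all of them from below. -/
theorem IsProfile.le_commonSubtreeSum {j h : ℕ} {N N' : List ℕ → ℕ} {L : ℕ → ℕ} {a b η : ℝ}
    {G : (List ℕ → ℕ) × (List ℕ → ℕ) → ℝ≥0∞}
    (hG : ∀ N N' K, IsProfile h N N' K → ENNReal.ofReal (Real.exp (b + η * K h)) ≤ G (N, N'))
    (hL : IsProfile (j + h) N N' L) :
    ENNReal.ofReal (Real.exp (-a * ∑ s ∈ Finset.range j, (L (s + 1) : ℝ) + b * L j +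
      η * L (j + h))) ≤
      commonSubtreeSum (ENNReal.ofReal (Real.exp (-a))) G j (N, N') := by
  induction j generalizing N N' L with
  | zero =>
    rw [zero_add] at hL ⊢
    simpa [hL.apply_zero, commonSubtreeSum] using hG N N' L hL
  | succ j ih =>
    rw [Nat.add_right_comm] at hL
    obtain ⟨S, hS, σ, K, hK, h0, hL⟩ := hL
    refine le_trans (le_of_eq ?_) (((Finset.prod_le_prod' fun i _ => ?_).trans
      (prod_le_matchSum _ hS σ) :
        ∏ i : S, ENNReal.ofReal (Real.exp (-a + (-a * ∑ s ∈ Finset.range j, (K i (s + 1) : ℝ) +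
          b * K i j + η * K i (j + h)))) ≤ _))
    · rw [← ENNReal.ofReal_prod_of_nonneg fun _ _ => (Real.exp_pos _).le, ← Real.exp_sum,
        Finset.sum_range_succ', zero_add, Nat.add_right_comm, hL, hL, hL]
      simp only [hL, Nat.cast_sum, (hK _).apply_zero, Finset.sum_add_distrib, ← Finset.mul_sum]
      rw [Finset.sum_comm]
      congr 2
      simp
      ring
    · rw [Real.exp_add, ENNReal.ofReal_mul (Real.exp_pos _).le]
      exact mul_le_mul_right (ih (hK i)) _

/-- The tree with offspring numbers `N` has a vertex at depth `h`. -/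
def Survives : ℕ → (List ℕ → ℕ) → Prop
  | 0, _ => True
  | h + 1, N => ∃ i < N [], Survives h (child N i)

theorem IsProfile.survives {h : ℕ} {N N' : List ℕ → ℕ} {L : ℕ → ℕ} (hL : IsProfile h N N' L) :
    Survives h N ∧ Survives h N' := by
  induction h generalizing N N' L with
  | zero => exact ⟨trivial, trivial⟩
  | succ h ih =>
    obtain ⟨S, hS, σ, K, hK, -⟩ := hL
    rw [Finset.mem_erase, Finset.mem_powerset] at hS
    obtain ⟨i, hi⟩ := Finset.nonempty_iff_ne_empty.2 hS.1
    obtain ⟨h1, h2⟩ := ih (hK ⟨i, hi⟩)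
    exact ⟨⟨i, Finset.mem_range.1 (hS.2 hi), h1⟩, ⟨_, (σ ⟨i, hi⟩).2, h2⟩⟩

/-! ### Survival and mean weights near criticality -/

theorem measurableSet_survives (h : ℕ) : MeasurableSet {N | Survives h N} := by
  induction h with
  | zero => exact MeasurableSet.univ
  | succ h ih =>
    have h1 : {N | Survives (h + 1) N} =
        ⋃ i : ℕ, {N : List ℕ → ℕ | i < N []} ∩ (fun N => child N i) ⁻¹' {N | Survives h N} := by
      ext N
      simp [Survives]
    rw [h1]
    exact MeasurableSet.iUnion fun i =>
      (measurableSet_lt measurable_const (measurable_pi_apply [])).inter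
        (measurable_child_apply i ih)

/-- The extinction probabilities are the iterates of the generating function of the Poisson
distribution. -/
theorem measure_not_survives_succ (l : ℝ≥0) (h : ℕ) :
    (offspringLaw l).real {N | ¬ Survives (h + 1) N} =
      Real.exp (l * (offspringLaw l).real {N | ¬ Survives h N} - l) := by
  have hm := (measurableSet_survives h).compl
  have hm' := (measurableSet_survives (h + 1)).compl
  set E : Set (List ℕ → ℕ) := {N | ¬ Survives h N} with hE
  have hmE : Measurable (E.indicator (1 : (List ℕ → ℕ) → ℝ≥0∞)) := measurable_one.indicator hm
  have hF : Measurable fun r : ℕ × (ℕ → List ℕ → ℕ) =>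
      ∏ i : Fin r.1, E.indicator (1 : (List ℕ → ℕ) → ℝ≥0∞) (r.2 i) := by
    have h1 : Measurable fun r : (ℕ → List ℕ → ℕ) × ℕ =>
        ∏ i : Fin r.2, E.indicator (1 : (List ℕ → ℕ) → ℝ≥0∞) (r.1 i) := by
      apply measurable_from_prod_countable_left
      intro a
      dsimp only
      have hi : ∀ i : ℕ, Measurable fun M : ℕ → List ℕ → ℕ =>
          E.indicator (1 : (List ℕ → ℕ) → ℝ≥0∞) (M i) := fun i => hmE.comp (measurable_pi_apply i)
      exact Finset.measurable_prod (Finset.univ : Finset (Fin a)) fun i _ => hi (i : ℕ)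
    exact h1.comp measurable_swap
  have h2 : ∀ N : List ℕ → ℕ, Set.indicator {N | Survives (h + 1) N}ᶜ (1 : (List ℕ → ℕ) → ℝ≥0∞) N =
      ∏ i : Fin (N []), E.indicator (1 : (List ℕ → ℕ) → ℝ≥0∞) (child N i) := by
    intro N
    by_cases hN : Survives (h + 1) N
    · rw [Set.indicator_of_notMem (by simpa using hN)]
      obtain ⟨i, hi, hs⟩ := hN
      refine (Finset.prod_eq_zero (Finset.mem_univ (⟨i, hi⟩ : Fin (N []))) ?_).symm
      exact Set.indicator_of_notMem (by simpa [hE] using hs) _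
    · rw [Set.indicator_of_mem (by simpa using hN)]
      refine (Finset.prod_eq_one fun i _ => ?_).symm
      refine Set.indicator_of_mem (s := E) ?_ _
      exact fun hs => hN ⟨i, i.2, hs⟩
  have h3 : ∫⁻ x, E.indicator (1 : (List ℕ → ℕ) → ℝ≥0∞) x ∂offspringLaw l =
      ((offspringLaw l E).toNNReal : ℝ≥0∞) := by
    rw [lintegral_indicator_one (μ := offspringLaw l) (s := E) hm, ENNReal.coe_toNNReal (measure_ne_top _ _)]
  have h4 := lintegral_indicator_one (μ := offspringLaw l) hm'
  rw [lintegral_congr (g := fun N => ∏ i : Fin (N []),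
      E.indicator (1 : (List ℕ → ℕ) → ℝ≥0∞) (child N i)) h2, lintegral_offspringLaw l hF] at h4
  have h5 : ∀ a : ℕ, ∫⁻ M : ℕ → List ℕ → ℕ,
      ∏ i : Fin a, E.indicator (1 : (List ℕ → ℕ) → ℝ≥0∞) (M i)
        ∂(Measure.infinitePi fun _ : ℕ => offspringLaw l) =
      ((offspringLaw l E).toNNReal : ℝ≥0∞) ^ a := by
    intro a
    rw [lintegral_prod_infinitePi (offspringLaw l) (σ := fun i : Fin a => (i : ℕ))
      (H := fun _ => E.indicator (1 : (List ℕ → ℕ) → ℝ≥0∞)) Fin.val_injective fun _ => hmE]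
    simp [h3]
  simp only [h5] at h4
  rw [lintegral_pow_poissonMeasure] at h4
  change (offspringLaw l {N | Survives (h + 1) N}ᶜ).toReal = _
  rw [← h4, ENNReal.toReal_ofReal (Real.exp_pos _).le]
  rfl

/-- Near criticality, survival is unlikely: its probability is at most of the order of the excess
of the mean offspring number over `1`. -/
theorem exists_measure_survives_le (l : ℝ≥0) {ε : ℝ} (hε : 0 < ε) (hl : (l : ℝ) = 1 + ε) :
    ∃ h, (offspringLaw l).real {N | Survives h N} ≤ 8 * ε := by
  by_contra! hcon
  have h1 : ∀ h, (offspringLaw l).real {N | ¬ Survives h N} =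
      1 - (offspringLaw l).real {N | Survives h N} := fun h =>
    probReal_compl_eq_one_sub (measurableSet_survives h)
  have hle : ∀ h, (offspringLaw l).real {N | Survives h N} ≤ 1 := fun h => measureReal_le_one
  have hε1 : 8 * ε < 1 := (hcon 0).trans_le (hle 0)
  have h2 : ∀ h, (offspringLaw l).real {N | Survives h N} ≤ (1 - ε) ^ h := by
    intro h
    induction h with
    | zero => simp
    | succ h ih =>
      have h3 := measure_not_survives_succ l h
      rw [h1, h1] at h3
      set q := (offspringLaw l).real {N | Survives h N} with hq
      have hq1 : q ≤ 1 := hle h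
      have hq8 : 8 * ε < q := hcon h
      -- `exp (-y) ≥ (1 - y / 2) ^ 2` for `y = l * q`
      have h4 : (1 - l * q / 2) ^ 2 ≤ Real.exp (l * (1 - q) - l) := by
        have h5 : 1 - l * q / 2 ≤ Real.exp (-(l * q / 2)) := by
          have := Real.add_one_le_exp (-(l * q / 2))
          linarith
        have h6 : 0 ≤ 1 - l * q / 2 := by rw [hl]; nlinarith
        calc (1 - l * q / 2) ^ 2 ≤ Real.exp (-(l * q / 2)) ^ 2 := pow_le_pow_left₀ h6 h5 2
          _ = Real.exp (l * (1 - q) - l) := by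
            rw [← Real.exp_nat_mul]
            congr 1
            push_cast
            ring
      have h7 : (offspringLaw l).real {N | Survives (h + 1) N} ≤ q * (1 - ε) := by
        have h8 : l * q - (l * q) ^ 2 / 4 ≤ q * (1 - ε) := by
          rw [hl]
          have h9 : (1 + ε) * (1 - (1 + ε) * q / 4) ≤ 1 - ε := by
            have h10 : 1 - (1 + ε) * q / 4 ≤ 1 - 2 * ε := by nlinarith
            nlinarith
          calc (1 + ε) * q - ((1 + ε) * q) ^ 2 / 4 = q * ((1 + ε) * (1 - (1 + ε) * q / 4)) := by
                ring
            _ ≤ q * (1 - ε) := mul_le_mul_of_nonneg_left h9 (by linarith)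
        nlinarith
      rw [pow_succ]
      exact h7.trans (mul_le_mul_of_nonneg_right ih (by linarith))
  obtain ⟨n, hn⟩ := exists_pow_lt_of_lt_one (by linarith : 0 < 8 * ε) (by linarith : 1 - ε < 1)
  linarith [hcon n, h2 n]

theorem lintegral_commonSubtreeSum_ne_top (l : ℝ≥0)
    {G : (List ℕ → ℕ) × (List ℕ → ℕ) → ℝ≥0∞} (hG : Measurable G)
    (hfin : ∫⁻ p, G p ∂(offspringLaw l).prod (offspringLaw l) ≠ ∞) (j : ℕ) :
    ∫⁻ p, commonSubtreeSum 1 G j p ∂(offspringLaw l).prod (offspringLaw l) ≠ ∞ := by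
  induction j with
  | zero => exact hfin
  | succ j ih =>
    have h := lintegral_matchSum l ((measurable_commonSubtreeSum (x := 1) hG j).const_mul 1)
      (by simpa using (ENNReal.coe_toNNReal ih).symm)
    intro htop
    change ∫⁻ p, matchSum (fun p => 1 * commonSubtreeSum 1 G j p) p
      ∂(offspringLaw l).prod (offspringLaw l) = ∞ at htop
    rw [htop] at h
    simp at h

/-- With edge weight `exp (-3 * ε)` the recursion for the mean weights is
`c ↦ exp (u * c) - 1` for some `u ≤ 1 / (1 + ε)`, which maps `[0, ε]` into itself. -/
theorem lintegral_commonSubtreeSum_le (l : ℝ≥0) {ε : ℝ} (hε : 0 < ε) (hl : (l : ℝ) = 1 + ε)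
    {G : (List ℕ → ℕ) × (List ℕ → ℕ) → ℝ≥0∞} (hG : Measurable G)
    (hle : ∫⁻ p, G p ∂(offspringLaw l).prod (offspringLaw l) ≤ ENNReal.ofReal ε) (j : ℕ) :
    ∫⁻ p, commonSubtreeSum (ENNReal.ofReal (Real.exp (-(3 * ε)))) G j p
      ∂(offspringLaw l).prod (offspringLaw l) ≤ ENNReal.ofReal ε := by
  induction j with
  | zero => exact hle
  | succ j ih =>
    set x : ℝ≥0∞ := ENNReal.ofReal (Real.exp (-(3 * ε))) with hx
    have hm := measurable_commonSubtreeSum (x := x) hG j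
    have h1 : ∫⁻ p, x * commonSubtreeSum x G j p ∂(offspringLaw l).prod (offspringLaw l) ≤
        ENNReal.ofReal (Real.exp (-(3 * ε)) * ε) := by
      rw [lintegral_const_mul _ hm, ENNReal.ofReal_mul (Real.exp_pos _).le]
      exact mul_le_mul_right ih _
    have h2 := ne_top_of_le_ne_top ENNReal.ofReal_ne_top h1
    have h3 := lintegral_matchSum l (hm.const_mul x) (ENNReal.coe_toNNReal h2).symm
    set c := (∫⁻ p, x * commonSubtreeSum x G j p
      ∂(offspringLaw l).prod (offspringLaw l)).toNNReal with hc
    have hc1 : (c : ℝ) ≤ Real.exp (-(3 * ε)) * ε := by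
      have := ENNReal.toReal_mono ENNReal.ofReal_ne_top h1
      rwa [ENNReal.toReal_ofReal (by positivity)] at this
    have h4 : Real.exp (l ^ 2 * c) ≤ ε + 1 := by
      have h5 : (l : ℝ) ^ 2 ≤ Real.exp (2 * ε) := by
        have := Real.add_one_le_exp ε
        calc (l : ℝ) ^ 2 ≤ Real.exp ε ^ 2 := pow_le_pow_left₀ l.coe_nonneg (by linarith) 2
          _ = Real.exp (2 * ε) := by rw [← Real.exp_nat_mul]; norm_num
      have h6 : (l : ℝ) ^ 2 * c ≤ Real.exp (-ε) * ε :=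
        calc (l : ℝ) ^ 2 * c ≤ Real.exp (2 * ε) * (Real.exp (-(3 * ε)) * ε) :=
              mul_le_mul h5 hc1 c.coe_nonneg (Real.exp_pos _).le
          _ = Real.exp (-ε) * ε := by
              rw [← mul_assoc, ← Real.exp_add]
              ring_nf
      have h7 : Real.exp (-ε) ≤ (1 + ε)⁻¹ := by
        rw [Real.exp_neg]
        exact inv_anti₀ (by linarith) (by linarith [Real.add_one_le_exp ε])
      have h8 : (l : ℝ) ^ 2 * c ≤ 1 - (1 + ε)⁻¹ :=
        h6.trans ((mul_le_mul_of_nonneg_right h7 hε.le).trans_eq (by field_simp; ring))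
      have h9 : (1 + ε)⁻¹ ≤ Real.exp (-(l ^ 2 * c)) := by
        linarith [Real.add_one_le_exp (-((l : ℝ) ^ 2 * c))]
      rw [Real.exp_neg] at h9
      have := (inv_le_inv₀ (by linarith) (Real.exp_pos _)).1 h9
      linarith
    have h5 : ∫⁻ p, matchSum (fun p => x * commonSubtreeSum x G j p) p
        ∂(offspringLaw l).prod (offspringLaw l) + 1 ≤ ENNReal.ofReal ε + 1 := by
      rw [h3, ← ENNReal.ofReal_one, ← ENNReal.ofReal_add hε.le zero_le_one]
      exact ENNReal.ofReal_le_ofReal h4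
    exact (ENNReal.add_le_add_iff_right ENNReal.one_ne_top).1 h5

/-- If the leaves at depth `j` are required to have descendants `h` generations below, for a
suitable `h`, then each leaf may be given the weight `exp 10`, and in addition `exp η` for each of
these descendants, while the mean total weight of the common subtrees stays at most `ε`. -/
theorem exists_leafWeight (l : ℝ≥0) {ε : ℝ} (hε : 0 < ε) (hε' : ε ≤ Real.exp (-10) / 128)
    (hl : (l : ℝ) = 1 + ε) :
    ∃ (h : ℕ) (η : ℝ) (G : (List ℕ → ℕ) × (List ℕ → ℕ) → ℝ≥0∞), 0 < η ∧ Measurable G ∧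
      (∀ N N' K, IsProfile h N N' K →
        ENNReal.ofReal (Real.exp (10 + η * K h)) ≤ G (N, N')) ∧
      ∫⁻ p, G p ∂(offspringLaw l).prod (offspringLaw l) ≤ ENNReal.ofReal ε := by
  obtain ⟨h, hq⟩ := exists_measure_survives_le l hε hl
  set H := commonSubtreeSum 1 (fun _ => ENNReal.ofReal (Real.exp 2)) h with hH
  have hHm : Measurable H := measurable_commonSubtreeSum measurable_const h
  have hHfin : ∫⁻ p, H p ∂(offspringLaw l).prod (offspringLaw l) ≠ ∞ :=
    lintegral_commonSubtreeSum_ne_top l measurable_const (by simp) h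
  have hHK : ∀ N N' K, IsProfile h N N' K → ENNReal.ofReal (Real.exp (2 * K h)) ≤ H (N, N') := by
    intro N N' K hK
    have := IsProfile.le_commonSubtreeSum (h := 0) (j := h) (a := 0) (b := 0) (η := 2)
      (G := fun _ => ENNReal.ofReal (Real.exp 2))
      (fun N N' K hK => by simp [hK.apply_zero]) hK
    simpa using this
  -- `η` is small enough for the second part of the weight to have mean at most `64 * ε ^ 2`, the
  -- bound for the square of the survival probability.
  set B := (∫⁻ p, H p ∂(offspringLaw l).prod (offspringLaw l)).toReal with hB
  have hB0 : 0 ≤ B := ENNReal.toReal_nonneg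
  set η := min 1 (64 * ε ^ 2 / (B + 1)) with hη
  have hη0 : 0 < η := lt_min one_pos (by positivity)
  have hηB : η * B ≤ 64 * ε ^ 2 := by
    have h1 : η * (B + 1) ≤ 64 * ε ^ 2 :=
      (mul_le_mul_of_nonneg_right (min_le_right _ _) (by positivity)).trans_eq
        (by field_simp)
    linarith
  set E : Set (List ℕ → ℕ) := {N | Survives h N} with hE
  have hEm : MeasurableSet E := measurableSet_survives h
  refine ⟨h, η, fun p => ENNReal.ofReal (Real.exp 10) *
    ((E ×ˢ E).indicator 1 p + ENNReal.ofReal η * H p), hη0, ?_, ?_, ?_⟩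
  · exact ((measurable_one.indicator (hEm.prod hEm)).add (hHm.const_mul _)).const_mul _
  · intro N N' K hK
    have h1 : (E ×ˢ E).indicator (1 : (List ℕ → ℕ) × (List ℕ → ℕ) → ℝ≥0∞) (N, N') = 1 :=
      Set.indicator_of_mem (s := E ×ˢ E) hK.survives _
    beta_reduce
    rw [h1, Real.exp_add, ENNReal.ofReal_mul (Real.exp_pos _).le]
    refine mul_le_mul_right ?_ _
    have hk : (0 : ℝ) ≤ K h := Nat.cast_nonneg _
    -- `exp y - 1 ≤ y * exp y` for `y = η * K h`
    have h2 : Real.exp (η * K h) ≤ 1 + η * Real.exp (2 * K h) := by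
      have h3 := Real.add_one_le_exp (-(η * K h))
      have h4 : Real.exp (-(η * K h)) * Real.exp (η * K h) = 1 := by
        rw [← Real.exp_add]; simp
      have h5 : Real.exp (η * K h) - 1 ≤ η * K h * Real.exp (η * K h) := by
        nlinarith [Real.exp_pos (η * K h)]
      have h6 : K h * Real.exp (η * K h) ≤ Real.exp (2 * K h) := by
        rw [two_mul, Real.exp_add]
        refine mul_le_mul (by linarith [Real.add_one_le_exp (K h : ℝ)]) ?_ (Real.exp_pos _).le
          (Real.exp_pos _).le
        exact Real.exp_le_exp.2 (mul_le_of_le_one_left hk (min_le_left _ _))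
      nlinarith
    refine (ENNReal.ofReal_le_ofReal h2).trans ?_
    rw [ENNReal.ofReal_add zero_le_one (by positivity), ENNReal.ofReal_one,
      ENNReal.ofReal_mul hη0.le]
    exact add_le_add_right (mul_le_mul_right (hHK N N' K hK) _) _
  · beta_reduce
    rw [lintegral_const_mul (f := fun p => (E ×ˢ E).indicator 1 p + ENNReal.ofReal η * H p) _
        ((measurable_one.indicator (hEm.prod hEm)).add (hHm.const_mul _)),
      lintegral_add_left (measurable_one.indicator (hEm.prod hEm)),
      lintegral_indicator_one (hEm.prod hEm), lintegral_const_mul _ hHm, Measure.prod_prod,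
      ← ENNReal.ofReal_toReal hHfin, ← hB, ← ofReal_measureReal (s := E),
      ← ENNReal.ofReal_mul measureReal_nonneg, ← ENNReal.ofReal_mul hη0.le,
      ← ENNReal.ofReal_add (by positivity) (by positivity),
      ← ENNReal.ofReal_mul (Real.exp_pos _).le]
    refine ENNReal.ofReal_le_ofReal ?_
    have h1 : (offspringLaw l).real E * (offspringLaw l).real E ≤ 64 * ε ^ 2 := by
      nlinarith [measureReal_nonneg (μ := offspringLaw l) (s := E)]
    have h2 : Real.exp 10 * ε ≤ 1 / 128 := by
      calc Real.exp 10 * ε ≤ Real.exp 10 * (Real.exp (-10) / 128) :=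
            mul_le_mul_of_nonneg_left hε' (Real.exp_pos _).le
        _ = 1 / 128 := by rw [← mul_div_assoc, ← Real.exp_add]; simp
    calc _ ≤ Real.exp 10 * (64 * ε ^ 2 + 64 * ε ^ 2) :=
          mul_le_mul_of_nonneg_left (add_le_add h1 hηB) (Real.exp_pos _).le
      _ = Real.exp 10 * ε * (128 * ε) := by ring
      _ ≤ 1 / 128 * (128 * ε) := mul_le_mul_of_nonneg_right h2 (by positivity)
      _ = ε := by ring

/-! ### Cutting a common subtree and the first moment bound -/

/-- The left-hand side is the cost of the edges above depth `i`, summed as a geometric series. -/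
theorem sum_le_of_forall_le_pow {L : ℕ → ℕ} {ε A : ℝ} (hε : 0 < ε) (hε1 : ε ≤ 1) {i : ℕ}
    (hL : ∀ s ≤ i, (L s : ℝ) ≤ A * (1 + ε / 2) ^ s) :
    3 * ε * ∑ s ∈ Finset.range i, (L (s + 1) : ℝ) ≤ 9 * (A * (1 + ε / 2) ^ i) := by
  have hA : 0 ≤ A := by
    have := hL 0 (Nat.zero_le _)
    rw [pow_zero, mul_one] at this
    exact (Nat.cast_nonneg _).trans this
  have h1 : ∑ s ∈ Finset.range i, (L (s + 1) : ℝ) ≤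
      ∑ s ∈ Finset.range i, (A * (1 + ε / 2)) * (1 + ε / 2) ^ s := by
    refine Finset.sum_le_sum fun s hs => (hL (s + 1) (Finset.mem_range.1 hs)).trans_eq ?_
    ring
  rw [← Finset.mul_sum] at h1
  have h2 : ε / 2 * ∑ s ∈ Finset.range i, (1 + ε / 2) ^ s = (1 + ε / 2) ^ i - 1 := by
    have := mul_geom_sum (1 + ε / 2) i
    rwa [add_sub_cancel_left] at this
  have h3 : 0 ≤ A * (1 + ε / 2) ^ i := by positivity
  calc 3 * ε * ∑ s ∈ Finset.range i, (L (s + 1) : ℝ)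
      ≤ 3 * ε * ((A * (1 + ε / 2)) * ∑ s ∈ Finset.range i, (1 + ε / 2) ^ s) :=
        mul_le_mul_of_nonneg_left h1 (by positivity)
    _ = 6 * (1 + ε / 2) * A * (ε / 2 * ∑ s ∈ Finset.range i, (1 + ε / 2) ^ s) := by ring
    _ = 6 * (1 + ε / 2) * (A * (1 + ε / 2) ^ i - A) := by rw [h2]; ring
    _ ≤ 9 * (A * (1 + ε / 2) ^ i) := by nlinarith

/-- A depth at which cutting the subtree makes its weight large. If the number of vertices at depth
`s`, divided by `(1 + ε / 2) ^ s`, is maximal at `s = j`, then the part above depth `j` has at most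
`3 / ε` edges for each of its leaves. This `j` serves unless the maximum is small compared
with the number at depth `D + h`; then the final depth `D` serves. -/
theorem exists_cut_depth (L : ℕ → ℕ) {ε η : ℝ} (hε : 0 < ε) (hε1 : ε ≤ 1) (hη : 0 < η)
    (D h : ℕ) :
    ∃ j ≤ D, η / 18 * L (D + h) / (1 + ε / 2) ^ (D + h) ≤
      -(3 * ε) * ∑ s ∈ Finset.range j, (L (s + 1) : ℝ) + 10 * L j + η * L (j + h) := by
  have hμ : ∀ n : ℕ, 1 ≤ (1 + ε / 2) ^ n := fun n => one_le_pow₀ (by linarith)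
  have hμ0 : ∀ n : ℕ, 0 < (1 + ε / 2) ^ n := fun n => by positivity
  obtain ⟨j, hj, hmax⟩ := Finset.exists_max_image (Finset.range (D + 1))
    (fun i => (L i : ℝ) / (1 + ε / 2) ^ i) ⟨0, by simp⟩
  have hjD : j ≤ D := by have := Finset.mem_range.1 hj; omega
  set A := (L j : ℝ) / (1 + ε / 2) ^ j with hA
  have hA0 : 0 ≤ A := by positivity
  have hAj : A * (1 + ε / 2) ^ j = L j := div_mul_cancel₀ _ (hμ0 j).ne'
  have hLA : ∀ s ≤ D, (L s : ℝ) ≤ A * (1 + ε / 2) ^ s := fun s hs =>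
    (div_le_iff₀ (hμ0 s)).1 (hmax s (Finset.mem_range.2 (by omega)))
  rcases le_or_gt (η / 18 * L (D + h) / (1 + ε / 2) ^ (D + h)) A with hc | hc
  · refine ⟨j, hjD, ?_⟩
    have h1 := sum_le_of_forall_le_pow hε hε1 (i := j) fun s hs => hLA s (hs.trans hjD)
    rw [hAj] at h1
    have h2 : A ≤ L j := by
      rw [← hAj]
      exact le_mul_of_one_le_right hA0 (hμ j)
    have h3 : 0 ≤ η * (L (j + h) : ℝ) := by positivity
    linarith
  · refine ⟨D, le_rfl, ?_⟩
    have h1 := sum_le_of_forall_le_pow hε hε1 (i := D) hLA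
    have h2 : A * (1 + ε / 2) ^ D ≤ η / 18 * L (D + h) := by
      rw [lt_div_iff₀ (hμ0 _)] at hc
      refine le_trans ?_ hc.le
      exact mul_le_mul_of_nonneg_left (pow_le_pow_right₀ (by linarith) (Nat.le_add_right _ _)) hA0
    have h3 : η / 18 * L (D + h) / (1 + ε / 2) ^ (D + h) ≤ η / 18 * L (D + h) :=
      div_le_self (by positivity) (hμ _)
    have h4 : (0 : ℝ) ≤ L D := Nat.cast_nonneg _
    have h5 : 0 ≤ η * (L (D + h) : ℝ) := by positivity
    linarith

theorem exists_isProfile_of_le_matchingWeight {d : ℕ} {N N' : List ℕ → ℕ} {y : ℝ} (hy : 0 < y)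
    (h : (y : EReal) ≤
      (((matchingWeight d (ofOffspring N) (ofOffspring N') : ℕ∞) : ℝ≥0∞) : EReal)) :
    ∃ L, IsProfile d N N' L ∧ y ≤ L d := by
  by_contra! hcon
  -- The supremum is bounded by the largest integer below `y`.
  have h0 : 0 < ⌈y⌉₊ := Nat.ceil_pos.2 hy
  have h1 : matchingWeight d (ofOffspring N) (ofOffspring N') ≤ ((⌈y⌉₊ - 1 : ℕ) : ℕ∞) := by
    refine iSup₂_le fun t ht => ?_
    obtain ⟨L, hL, hLd⟩ := exists_isProfile_of_mem_commonSubtrees ht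
    rw [hLd]
    have h2 : L d < ⌈y⌉₊ := Nat.lt_ceil.2 (hcon L hL)
    exact_mod_cast (by omega : L d ≤ ⌈y⌉₊ - 1)
  have h2 : (y : EReal) ≤ (((((⌈y⌉₊ - 1 : ℕ) : ℕ∞) : ℝ≥0∞)) : EReal) :=
    h.trans (EReal.coe_ennreal_le_coe_ennreal_iff.2 (ENat.toENNReal_le.2 h1))
  have h3 : y ≤ ((⌈y⌉₊ - 1 : ℕ) : ℝ) := by
    generalize ⌈y⌉₊ - 1 = n at h2
    have h3 : (((n : ℝ≥0∞)) : EReal) = ((n : ℝ) : EReal) := by norm_cast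
    rw [ENat.toENNReal_coe, h3] at h2
    exact EReal.coe_le_coe_iff.1 h2
  have h4 : ⌈y⌉₊ ≤ ⌈y⌉₊ - 1 := Nat.ceil_le.2 h3
  omega

/-- The first moment bound, with a doubly exponential decay in `d` when `y` exceeds
`(1 + ε / 2) ^ d` by an exponential factor. -/
theorem exists_measure_matchingWeight_le (l : ℝ≥0) {ε : ℝ} (hε : 0 < ε)
    (hε' : ε ≤ Real.exp (-10) / 128) (hl : (l : ℝ) = 1 + ε) :
    ∃ (h : ℕ) (κ : ℝ), 0 < κ ∧ ∀ d, h ≤ d → ∀ y : ℝ, 0 < y →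
      (offspringLaw l).prod (offspringLaw l) {ω | (y : EReal) ≤
        (((matchingWeight d (ofOffspring ω.1) (ofOffspring ω.2) : ℕ∞) : ℝ≥0∞) : EReal)} ≤
      ENNReal.ofReal ((d + 1) * Real.exp (-(κ * y / (1 + ε / 2) ^ d))) := by
  obtain ⟨h, η, G, hη, hG, hGK, hGε⟩ := exists_leafWeight l hε hε' hl
  have hε1 : ε ≤ 1 := by
    have : Real.exp (-10) ≤ 1 := Real.exp_le_one_iff.2 (by norm_num)
    linarith
  refine ⟨h, η / 18, by positivity, fun d hd y hy => ?_⟩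
  obtain ⟨D, rfl⟩ := Nat.exists_eq_add_of_le' hd
  set x : ℝ≥0∞ := ENNReal.ofReal (Real.exp (-(3 * ε))) with hx
  set b : ℝ := η / 18 * y / (1 + ε / 2) ^ (D + h) with hb
  have hsub : {ω : (List ℕ → ℕ) × (List ℕ → ℕ) | (y : EReal) ≤
      (((matchingWeight (D + h) (ofOffspring ω.1) (ofOffspring ω.2) : ℕ∞) : ℝ≥0∞) : EReal)} ⊆
      ⋃ j ∈ Finset.range (D + 1),
        {ω | ENNReal.ofReal (Real.exp b) ≤ commonSubtreeSum x G j ω} := by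
    rintro ⟨N, N'⟩ hω
    obtain ⟨L, hL, hyL⟩ := exists_isProfile_of_le_matchingWeight hy hω
    obtain ⟨j, hj, hjL⟩ := exists_cut_depth L hε hε1 hη D h
    simp only [Set.mem_iUnion]
    refine ⟨j, Finset.mem_range.2 (by omega), ?_⟩
    have hL' : IsProfile (j + h) N N' L := by
      refine IsProfile.of_add (k := D - j) ?_
      rwa [show j + h + (D - j) = D + h by omega]
    refine le_trans (ENNReal.ofReal_le_ofReal (Real.exp_le_exp.2 ?_))
      (hL'.le_commonSubtreeSum (a := 3 * ε) (b := 10) hGK)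
    refine le_trans ?_ hjL
    rw [hb]
    gcongr
  refine (measure_mono hsub).trans ((measure_biUnion_finset_le _ _).trans ?_)
  have hj : ∀ j ∈ Finset.range (D + 1), (offspringLaw l).prod (offspringLaw l)
      {ω | ENNReal.ofReal (Real.exp b) ≤ commonSubtreeSum x G j ω} ≤
      ENNReal.ofReal (Real.exp (-b)) := by
    intro j _
    have h1 := lintegral_commonSubtreeSum_le l hε hl hG hGε j
    refine (meas_ge_le_lintegral_div (measurable_commonSubtreeSum hG j).aemeasurable
      (by simp [Real.exp_pos]) ENNReal.ofReal_ne_top).trans ?_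
    rw [Real.exp_neg, ENNReal.ofReal_inv_of_pos (Real.exp_pos _), div_eq_mul_inv]
    refine mul_le_of_le_one_left' (h1.trans ?_)
    rw [← ENNReal.ofReal_one]
    exact ENNReal.ofReal_le_ofReal hε1
  refine (Finset.sum_le_card_nsmul _ _ _ hj).trans ?_
  rw [Finset.card_range, nsmul_eq_mul, ← ENNReal.ofReal_natCast,
    ← ENNReal.ofReal_mul (Nat.cast_nonneg _)]
  refine ENNReal.ofReal_le_ofReal (mul_le_mul_of_nonneg_right ?_ (Real.exp_pos _).le)
  push_cast
  linarith [(Nat.cast_nonneg h : (0 : ℝ) ≤ h)]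

/-- Any rate above `1 + ε / 2` would do; `1 + 3 * ε / 4` lies between it and the mean `1 + ε`. -/
theorem mem_controlledRates (l : ℝ≥0) {ε : ℝ} (hε : 0 < ε)
    (hε' : ε ≤ Real.exp (-10) / 128) (hl : (l : ℝ) = 1 + ε) :
    1 + 3 * ε / 4 ∈ controlledRates ((offspringLaw l).prod (offspringLaw l))
      (fun N => ofOffspring N.1) (fun N => ofOffspring N.2) := by
  obtain ⟨h, κ, hκ, hP⟩ := exists_measure_matchingWeight_le l hε hε' hl
  set g := 1 + 3 * ε / 4 with hg
  set μ := 1 + ε / 2 with hμ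
  have hμ0 : 0 < μ := by linarith
  have hr : 1 < g / μ := by
    rw [one_lt_div hμ0]
    linarith
  obtain ⟨d₁, hd₁⟩ : ∃ d₁ : ℕ, ∀ d ≥ d₁, (d : ℝ) + 1 ≤ κ * (g / μ) ^ d := by
    have h1 := tendsto_pow_const_div_const_pow_of_one_lt 1 hr
    have h2 := tendsto_pow_const_div_const_pow_of_one_lt 0 hr
    have h3 := (h1.add h2).eventually (gt_mem_nhds (show (0 : ℝ) + 0 < κ by simpa using hκ))
    obtain ⟨d₁, h4⟩ := Filter.eventually_atTop.1 h3
    refine ⟨d₁, fun d hd => ?_⟩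
    have h5 := h4 d hd
    rw [pow_one, pow_zero, ← add_div, div_lt_iff₀ (by positivity)] at h5
    exact h5.le
  refine ⟨1, 1, max (max h d₁) 1, one_pos, one_pos, by simp, fun x hx d hd => ?_⟩
  have hdh : h ≤ d := (le_max_left h d₁).trans ((le_max_left _ _).trans hd)
  have hdd : d₁ ≤ d := (le_max_right h d₁).trans ((le_max_left _ _).trans hd)
  -- For `x ≤ 1` the bound is trivial. For `x > 1` the exponent, at least `x * (d + 1)`, absorbs the
  -- factor `d + 1`.
  rcases le_or_gt x 1 with hx1 | hx1
  · rw [max_eq_right (by linarith), neg_zero, Real.exp_zero, ENNReal.ofReal_one]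
    exact prob_le_one
  · have hg0 : 0 < g := by linarith
    refine (hP d hdh (1 * x * g ^ d) (by positivity)).trans (ENNReal.ofReal_le_ofReal ?_)
    rw [max_eq_left (by linarith)]
    have h1 : (d : ℝ) + 1 ≤ Real.exp d := Real.add_one_le_exp _
    have h2 : κ * (1 * x * g ^ d) / μ ^ d = x * (κ * (g / μ) ^ d) := by
      rw [div_pow]
      ring
    have h3 : x * ((d : ℝ) + 1) ≤ x * (κ * (g / μ) ^ d) :=
      mul_le_mul_of_nonneg_left (hd₁ d hdd) hx
    have h4 : (d : ℝ) ≤ x * d := le_mul_of_one_le_left (Nat.cast_nonneg _) hx1.le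
    calc ((d : ℝ) + 1) * Real.exp (-(κ * (1 * x * g ^ d) / μ ^ d))
        ≤ Real.exp d * Real.exp (-(x * (d + 1))) := by
          rw [h2]
          exact mul_le_mul h1 (Real.exp_le_exp.2 (by linarith)) (Real.exp_pos _).le
            (Real.exp_pos _).le
      _ = Real.exp (d - x * (d + 1)) := by rw [← Real.exp_add, sub_eq_add_neg]
      _ ≤ Real.exp (-(x - 1)) := Real.exp_le_exp.2 (by linarith)

end TreeMatching

theorem mainTheorem2 :
    ∃ l₀ : ℝ≥0, 1 < l₀ ∧
      ∀ l : ℝ≥0, 1 < l → l ≤ l₀ →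
        TreeMatching.poissonMatchingRate l < ((l : ℝ) : EReal) := by
  have hpos : 0 < Real.exp (-10) / 128 := by positivity
  refine ⟨1 + ⟨Real.exp (-10) / 128, hpos.le⟩, ?_, fun l hl hl₀ => ?_⟩
  · exact lt_add_of_pos_right 1 (NNReal.coe_pos.1 hpos)
  · have h1 : (1 : ℝ) < l := hl
    have h2 : (l : ℝ) ≤ 1 + Real.exp (-10) / 128 := hl₀
    have h3 := TreeMatching.mem_controlledRates l (ε := l - 1) (by linarith) (by linarith)
      (by ring)
    refine lt_of_le_of_lt (iInf₂_le _ h3) ?_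
    exact EReal.coe_lt_coe_iff.2 (by linarith)
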